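/- **Theorem 2.1.** Let $K$ and $C$ be convex bodies (compact convex sets with non-empty interior) in $\mathbb{E}^d$, $d\ge 2$, and let $m\ge 1$ and $n\ge 1$ be integers. Definitions. For a convex body $L$ and a hyperplane $H$ let $w(L,H)$ be the distance between the two supporting hyperplanes of $L$ parallel to $H$; put $w_C(L,H)=w(L,H)/w(C,H)$ and let $w_C(L)=\min_H w_C(L,H)$ be the minimal $C$-width of $L$. The $C$-inradius $r$ of $L$ is the largest $\lambda>0$ such that a translate of $\lambda C$ is contained in $L$. For $0<\rho\le r$ the $\rho C$-rounded body $L^{\rho C}$ of $L$ is the union of all translates of $\rho C$ that are contained in $L$. For an integer $k\ge 1$ there is a unique $\rho\in(0,r]$ with $w_C(L^{\rho C})=k\rho$; it is called the $k$th successive $C$-inradius of $L$ and denoted by $r_C(L,k)$. A convex body is sliced into $n$ pieces by $n-1$ successive hyperplane cuts if one starts from the body itself as the only piece and, in each of $n-1$ steps, divides one of the current pieces by a hyperplane through its interior into its two (closed) parts, leaving the other pieces unchanged. Claim. Over all ways of slicing $K$ into $n$ pieces $K_1,\dots,K_n$ by $n-1$ successive hyperplane cuts, the minimum of $\max_{1\le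 i\le n} r_C(K_i,m)$ exists and equals $r_C(K,mn)$. Moreover, put $\rho=r_C(K,mn)$, let $H$ be any hyperplane with $w_C(K^{\rho C},H)=w_C(K^{\rho C})$ (such $H$ exist), and take the $n-1$ hyperplanes parallel to $H$ that divide the strip between the two supporting hyperplanes of $K^{\rho C}$ parallel to $H$ into $n$ strips of equal width. Slicing $K$ successively by these $n-1$ hyperplanes gives $n$ pieces whose greatest $m$th successive $C$-inradius is $r_C(K,mn)$, so that the minimum is attained there. -/

import Mathlib

noncomputable section

namespace SuccessiveInradii

/-- Euclidean `d`-space. -/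
abbrev E (d : ℕ) : Type := EuclideanSpace ℝ (Fin d)

/-- Unit vectors, the (oriented) unit normals of hyperplanes. -/
abbrev UnitVec (d : ℕ) : Type := Metric.sphere (0 : E d) 1

/-- A convex body: a compact convex set with non-empty interior. -/
structure IsConvexBody {d : ℕ} (K : Set (E d)) : Prop where
  isCompact : IsCompact K
  convex : Convex ℝ K
  interior_nonempty : (interior K).Nonempty

/-- The level of the upper supporting hyperplane of `K` with unit normal `u`. -/
def upperLevel {d : ℕ} (K : Set (E d)) (u : UnitVec d) : ℝ :=
  sSup ((fun x : E d => inner ℝ (u : E d) x) '' K)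

/-- The level of the lower supporting hyperplane of `K` with unit normal `u`. -/
def lowerLevel {d : ℕ} (K : Set (E d)) (u : UnitVec d) : ℝ :=
  sInf ((fun x : E d => inner ℝ (u : E d) x) '' K)

/-- `w(K, H)` for the hyperplanes `H` with unit normal `u`: the distance between the two
supporting hyperplanes of `K` that are orthogonal to `u`. -/
def width {d : ℕ} (K : Set (E d)) (u : UnitVec d) : ℝ :=
  upperLevel K u - lowerLevel K u

/-- The `C`-width of `K` parallel to the hyperplanes with unit normal `u`. -/
def relWidth {d : ℕ} (C K : Set (E d)) (u : UnitVec d) : ℝ :=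
  width K u / width C u

/-- The minimal `C`-width of `K`. -/
def minRelWidth {d : ℕ} (C K : Set (E d)) : ℝ :=
  ⨅ u : UnitVec d, relWidth C K u

/-- The translate `t + ρ C` of `ρ C`. -/
def homothet {d : ℕ} (t : E d) (ρ : ℝ) (C : Set (E d)) : Set (E d) :=
  (fun x : E d => t + ρ • x) '' C

/-- The `C`-inradius of `K`: the factor of the largest positive homothetic copy of `C`
a translate of which is contained in `K`. -/
def inradius {d : ℕ} (C K : Set (E d)) : ℝ :=
  sSup {ρ : ℝ | 0 < ρ ∧ ∃ t : E d, homothet t ρ C ⊆ K}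

/-- The `ρ C`-rounded body of `K`: the union of all translates of `ρ C` covered by `K`. -/
def roundedBody {d : ℕ} (C K : Set (E d)) (ρ : ℝ) : Set (E d) :=
  ⋃ t ∈ {t : E d | homothet t ρ C ⊆ K}, homothet t ρ C

/-- The defining property of the `m`-th successive `C`-inradius of `K`. -/
def IsSuccessiveInradius {d : ℕ} (C K : Set (E d)) (m : ℕ) (ρ : ℝ) : Prop :=
  0 < ρ ∧ ρ ≤ inradius C K ∧ minRelWidth C (roundedBody C K ρ) = m * ρ

/-- The `m`-th successive `C`-inradius `r_C(K, m)` of `K`, i.e. the element of the set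
below, which is a singleton for convex bodies `C`, `K` and `m ≥ 1`. -/
def successiveInradius {d : ℕ} (C K : Set (E d)) (m : ℕ) : ℝ :=
  sSup {ρ : ℝ | IsSuccessiveInradius C K m ρ}

/-- The hyperplane `{x | ⟨u, x⟩ = t}`, given by a unit normal `u` and a level `t`. -/
structure Hyperplane (d : ℕ) where
  normal : UnitVec d
  level : ℝ

/-- The points of a hyperplane. -/
def Hyperplane.points {d : ℕ} (H : Hyperplane d) : Set (E d) :=
  {x | inner ℝ (H.normal : E d) x = H.level}

/-- One of the two closed half-spaces bounded by a hyperplane. -/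
def Hyperplane.lower {d : ℕ} (H : Hyperplane d) : Set (E d) :=
  {x | inner ℝ (H.normal : E d) x ≤ H.level}

/-- The other closed half-space bounded by a hyperplane. -/
def Hyperplane.upper {d : ℕ} (H : Hyperplane d) : Set (E d) :=
  {x | H.level ≤ inner ℝ (H.normal : E d) x}

/-- `SlicedBy K cuts pieces`: the successive hyperplane cuts listed (chronologically) in `cuts`
slice `K` into `pieces`. Each cut divides exactly one of the pieces present at that moment, into
its two parts on either side of the hyperplane, and leaves the other pieces as they are. That the
hyperplane divides the piece means that it passes through the interior of the piece. -/
inductive SlicedBy {d : ℕ} (K : Set (E d)) : List (Hyperplane d) → Multiset (Set (E d)) → Prop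
  | uncut : SlicedBy K [] {K}
  | cut (cuts : List (Hyperplane d)) (P : Set (E d)) (rest : Multiset (Set (E d)))
      (H : Hyperplane d) (before : SlicedBy K cuts (P ::ₘ rest))
      (divides : (interior P ∩ H.points).Nonempty) :
      SlicedBy K (cuts ++ [H]) ((P ∩ H.lower) ::ₘ (P ∩ H.upper) ::ₘ rest)

/-- `k` successive cuts produce `k + 1` pieces. -/
theorem SlicedBy.card_pieces {d : ℕ} {K : Set (E d)} {cuts : List (Hyperplane d)}
    {pieces : Multiset (Set (E d))} (h : SlicedBy K cuts pieces) :
    pieces.card = cuts.length + 1 := by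
  induction h with
  | uncut => simp
  | cut cuts P rest H before divides ih => simpa using ih

/-- The pieces of a sliced convex body are convex bodies. -/
theorem SlicedBy.isConvexBody {d : ℕ} {K : Set (E d)} (hK : IsConvexBody K)
    {cuts : List (Hyperplane d)} {pieces : Multiset (Set (E d))} (h : SlicedBy K cuts pieces) :
    ∀ P ∈ pieces, IsConvexBody P := by
  induction h with
  | uncut => simpa using hK
  | cut cuts P rest H before divides ih =>
    have hP : IsConvexBody P := ih P (Multiset.mem_cons_self _ _)
    obtain ⟨x, hx, hxH⟩ := divides
    have hxH : inner ℝ (H.normal : E d) x = H.level := hxH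
    have hu : inner ℝ (H.normal : E d) (H.normal : E d) = 1 := by
      have h1 : ‖(H.normal : E d)‖ = 1 := by simp
      rw [real_inner_self_eq_norm_sq, h1]; norm_num
    have hcont : Continuous fun y : E d => inner ℝ (H.normal : E d) y := by fun_prop
    have hlin : IsLinearMap ℝ fun y : E d => inner ℝ (H.normal : E d) y :=
      (innerₛₗ ℝ (H.normal : E d)).isLinear
    obtain ⟨ε, hε, hball⟩ := Metric.isOpen_iff.1 isOpen_interior x hx
    have hmem : ∀ c : ℝ, |c| < ε → x + c • (H.normal : E d) ∈ interior P := by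
      intro c hc
      apply hball
      simpa [Metric.mem_ball, dist_eq_norm, norm_smul] using hc
    have hval : ∀ c : ℝ, inner ℝ (H.normal : E d) (x + c • (H.normal : E d)) = H.level + c := by
      intro c
      rw [inner_add_right, real_inner_smul_right, hu, hxH, mul_one]
    have hlow : IsConvexBody (P ∩ H.lower) := by
      refine ⟨hP.isCompact.inter_right (isClosed_le hcont continuous_const),
        hP.convex.inter (convex_halfSpace_le hlin _), x + (-(ε / 2)) • (H.normal : E d), ?_⟩
      rw [interior_inter]
      refine ⟨hmem _ (by rw [abs_neg, abs_of_pos (by linarith)]; linarith), ?_⟩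
      refine interior_maximal (s := H.lower) (t := {y | inner ℝ (H.normal : E d) y < H.level})
        (fun y (hy : inner ℝ (H.normal : E d) y < H.level) => hy.le) (isOpen_lt hcont continuous_const) ?_
      change inner ℝ (H.normal : E d) _ < H.level
      rw [hval]; linarith
    have hupp : IsConvexBody (P ∩ H.upper) := by
      refine ⟨hP.isCompact.inter_right (isClosed_le continuous_const hcont),
        hP.convex.inter (convex_halfSpace_ge hlin _), x + (ε / 2) • (H.normal : E d), ?_⟩
      rw [interior_inter]
      refine ⟨hmem _ (by rw [abs_of_pos (by linarith)]; linarith), ?_⟩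
      refine interior_maximal (s := H.upper) (t := {y | H.level < inner ℝ (H.normal : E d) y})
        (fun y (hy : H.level < inner ℝ (H.normal : E d) y) => hy.le) (isOpen_lt continuous_const hcont) ?_
      change H.level < inner ℝ (H.normal : E d) _
      rw [hval]; linarith
    intro Q hQ
    rcases Multiset.mem_cons.1 hQ with rfl | hQ
    · exact hlow
    rcases Multiset.mem_cons.1 hQ with rfl | hQ
    · exact hupp
    · exact ih Q (Multiset.mem_cons_of_mem hQ)

/-- `M` is the greatest `m`-th successive `C`-inradius of the pieces. -/
def IsGreatestInradius {d : ℕ} (C : Set (E d)) (m : ℕ) (pieces : Multiset (Set (E d)))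
    (M : ℝ) : Prop :=
  IsGreatest {r : ℝ | ∃ P ∈ pieces, r = successiveInradius C P m} M

/-- The `n - 1` hyperplanes with unit normal `u` that are equally spaced along the width of `L`
in direction `u`: they divide the strip between the two supporting hyperplanes of `L` orthogonal
to `u` into `n` strips of equal width. -/
def equallySpacedCuts {d : ℕ} (L : Set (E d)) (u : UnitVec d) (n : ℕ) : List (Hyperplane d) :=
  (List.range (n - 1)).map fun i =>
    { normal := u
      level := lowerLevel L u + ((i : ℝ) + 1) * (width L u / n) }

end SuccessiveInradii

end

open SuccessiveInradii

/-!
Write `g_L(ρ)` for the minimal `C`-width of the erosion of `L` by `ρC`. The rounded body of `L` has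
minimal `C`-width `g_L(ρ) + ρ`, so `r_C(L, k)` is the root of `g_L(ρ) + ρ = kρ`, and since `g_L` is
concave and decreases at rate at least one, this root exists, is unique and compares with any `ρ`
according to the sign of `g_L(ρ) + ρ - kρ`.

A hyperplane cutting `P` into `P₁` and `P₂` removes from the erosion of `P` a strip of relative
width `ρ`. An inequality for two planks covering a convex set then gives
`g_P(ρ) ≤ g_{P₁}(ρ) + g_{P₂}(ρ) + ρ`, that is, `g + ρ` is subadditive under cuts. At the greatest
`m`-th inradius `ρ` of the `n` pieces this yields `g_K(ρ) + ρ ≤ mnρ`, hence `r_C(K, mn) ≤ ρ`.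
Conversely, cuts parallel to a direction of minimal width of the rounded body leave it in strips of
relative width `mρ`, and the rounded body of each piece lies in one of them.
-/

namespace SuccessiveInradii

open Set Filter Topology
open scoped Pointwise

section Width

variable {d : ℕ} {C L S T : Set (E d)} {u : UnitVec d} {ρ : ℝ}

theorem isCompact_image_inner (hL : IsCompact L) (u : UnitVec d) :
    IsCompact ((fun x : E d => inner ℝ (u : E d) x) '' L) :=
  hL.image (by fun_prop)

theorem inner_le_upperLevel (hL : IsCompact L) {x : E d} (hx : x ∈ L) :
    inner ℝ (u : E d) x ≤ upperLevel L u :=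
  le_csSup (isCompact_image_inner hL u).bddAbove (mem_image_of_mem _ hx)

theorem lowerLevel_le_inner (hL : IsCompact L) {x : E d} (hx : x ∈ L) :
    lowerLevel L u ≤ inner ℝ (u : E d) x :=
  csInf_le (isCompact_image_inner hL u).bddBelow (mem_image_of_mem _ hx)

theorem exists_inner_eq_upperLevel (hL : IsCompact L) (hne : L.Nonempty) (u : UnitVec d) :
    ∃ x ∈ L, inner ℝ (u : E d) x = upperLevel L u :=
  (isCompact_image_inner hL u).sSup_mem (hne.image _)

theorem exists_inner_eq_lowerLevel (hL : IsCompact L) (hne : L.Nonempty) (u : UnitVec d) :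
    ∃ x ∈ L, inner ℝ (u : E d) x = lowerLevel L u :=
  (isCompact_image_inner hL u).sInf_mem (hne.image _)

theorem inner_sub_inner_le_width (hL : IsCompact L) {x y : E d} (hx : x ∈ L) (hy : y ∈ L) :
    inner ℝ (u : E d) x - inner ℝ (u : E d) y ≤ width L u :=
  sub_le_sub (inner_le_upperLevel hL hx) (lowerLevel_le_inner hL hy)

theorem exists_inner_sub_inner_eq_width (hL : IsCompact L) (hne : L.Nonempty) (u : UnitVec d) :
    ∃ x ∈ L, ∃ y ∈ L, inner ℝ (u : E d) x - inner ℝ (u : E d) y = width L u := by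
  obtain ⟨x, hx, hxu⟩ := exists_inner_eq_upperLevel hL hne u
  obtain ⟨y, hy, hyu⟩ := exists_inner_eq_lowerLevel hL hne u
  exact ⟨x, hx, y, hy, by rw [hxu, hyu, width]⟩

theorem width_empty : width (∅ : Set (E d)) u = 0 := by
  simp [width, upperLevel, lowerLevel]

theorem width_nonneg (hL : IsCompact L) (u : UnitVec d) : 0 ≤ width L u := by
  rcases L.eq_empty_or_nonempty with rfl | ⟨x, hx⟩
  · rw [width_empty]
  · simpa only [sub_self] using inner_sub_inner_le_width hL hx hx

theorem upperLevel_mono (hS : S.Nonempty) (hT : IsCompact T) (hST : S ⊆ T) :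
    upperLevel S u ≤ upperLevel T u :=
  csSup_le_csSup (isCompact_image_inner hT u).bddAbove (hS.image _) (image_mono hST)

theorem lowerLevel_anti (hS : S.Nonempty) (hT : IsCompact T) (hST : S ⊆ T) :
    lowerLevel T u ≤ lowerLevel S u :=
  csInf_le_csInf (isCompact_image_inner hT u).bddBelow (hS.image _) (image_mono hST)

theorem width_mono (hT : IsCompact T) (hST : S ⊆ T) : width S u ≤ width T u := by
  rcases S.eq_empty_or_nonempty with rfl | hS
  · exact width_empty.trans_le (width_nonneg hT u)
  · exact sub_le_sub (upperLevel_mono hS hT hST) (lowerLevel_anti hS hT hST)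

theorem width_add (hS : IsCompact S) (hS₀ : S.Nonempty) (hT : IsCompact T) (hT₀ : T.Nonempty) :
    width (S + T) u = width S u + width T u := by
  have himage : (fun x : E d => inner ℝ (u : E d) x) '' (S + T) =
      (fun x => inner ℝ (u : E d) x) '' S + (fun x => inner ℝ (u : E d) x) '' T :=
    image_add (innerSL ℝ (u : E d))
  have hSu := isCompact_image_inner hS u
  have hTu := isCompact_image_inner hT u
  rw [width, upperLevel, lowerLevel, himage,
    csSup_add (hS₀.image _) hSu.bddAbove (hT₀.image _) hTu.bddAbove,
    csInf_add (hS₀.image _) hSu.bddBelow (hT₀.image _) hTu.bddBelow]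
  exact add_sub_add_comm ..

theorem width_smul (hρ : 0 ≤ ρ) (S : Set (E d)) (u : UnitVec d) :
    width (ρ • S) u = ρ * width S u := by
  have himage : (fun x : E d => inner ℝ (u : E d) x) '' (ρ • S) =
      ρ • (fun x : E d => inner ℝ (u : E d) x) '' S :=
    image_smul_comm _ _ _ fun x => map_smul (innerSL ℝ (u : E d)) ρ x
  rw [width, upperLevel, lowerLevel, himage, Real.sSup_smul_of_nonneg hρ,
    Real.sInf_smul_of_nonneg hρ, smul_eq_mul, smul_eq_mul, ← mul_sub]
  rfl

theorem width_vadd (hS : IsCompact S) (x : E d) : width (x +ᵥ S) u = width S u := by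
  rcases S.eq_empty_or_nonempty with rfl | hS₀
  · rw [vadd_set_empty]
  · rw [← singleton_vadd, vadd_eq_add,
      width_add isCompact_singleton (singleton_nonempty x) hS hS₀]
    simp [width, upperLevel, lowerLevel]

theorem inner_unitVec_self (u : UnitVec d) : inner ℝ (u : E d) (u : E d) = 1 := by
  rw [real_inner_self_eq_norm_sq, norm_eq_of_mem_sphere, one_pow]

theorem IsConvexBody.width_pos (hC : IsConvexBody C) (u : UnitVec d) : 0 < width C u := by
  obtain ⟨x, hx⟩ := hC.interior_nonempty
  have hline : Tendsto (fun t : ℝ => x + t • (u : E d)) (𝓝 0) (𝓝 x) :=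
    Continuous.tendsto' (by fun_prop) _ _ (by simp)
  obtain ⟨t, ht, hxt⟩ := (hline.eventually (mem_interior_iff_mem_nhds.1 hx)).exists_gt
  calc 0 < t := ht
    _ = inner ℝ (u : E d) (x + t • (u : E d)) - inner ℝ (u : E d) x := by
      rw [inner_add_right, real_inner_smul_right, inner_unitVec_self, mul_one,
        add_sub_cancel_left]
    _ ≤ width C u := inner_sub_inner_le_width hC.isCompact hxt (interior_subset hx)

theorem IsConvexBody.nonempty (hC : IsConvexBody C) : C.Nonempty :=
  hC.interior_nonempty.mono interior_subset

theorem continuous_width (hL : IsCompact L) : Continuous (width L) :=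
  .sub (hL.continuous_sSup (f := fun (u : UnitVec d) (x : E d) => inner ℝ (u : E d) x)
      (by fun_prop))
    (hL.continuous_sInf (f := fun (u : UnitVec d) (x : E d) => inner ℝ (u : E d) x)
      (by fun_prop))

end Width

section MinRelWidth

variable {d : ℕ} {C L S T : Set (E d)} {ρ : ℝ}

theorem relWidth_nonneg (hC : IsCompact C) (hL : IsCompact L) (u : UnitVec d) :
    0 ≤ relWidth C L u :=
  div_nonneg (width_nonneg hL u) (width_nonneg hC u)

theorem bddBelow_range_relWidth (hC : IsCompact C) (hL : IsCompact L) :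
    BddBelow (range (relWidth C L)) :=
  ⟨0, forall_mem_range.2 (relWidth_nonneg hC hL)⟩

theorem minRelWidth_nonneg (hC : IsCompact C) (hL : IsCompact L) : 0 ≤ minRelWidth C L :=
  Real.iInf_nonneg (relWidth_nonneg hC hL)

theorem minRelWidth_mul_width_le (hC : IsConvexBody C) (hL : IsCompact L) (u : UnitVec d) :
    minRelWidth C L * width C u ≤ width L u :=
  (le_div_iff₀ (hC.width_pos u)).1 (ciInf_le (bddBelow_range_relWidth hC.isCompact hL) u)

theorem minRelWidth_empty : minRelWidth C (∅ : Set (E d)) = 0 := by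
  simp [minRelWidth, relWidth, width_empty]

theorem nonempty_of_minRelWidth_pos (h : 0 < minRelWidth C S) : S.Nonempty :=
  nonempty_iff_ne_empty.2 fun hS => h.ne' (hS ▸ minRelWidth_empty)

theorem minRelWidth_smul (hρ : 0 ≤ ρ) : minRelWidth C (ρ • S) = ρ * minRelWidth C S := by
  simp only [minRelWidth, relWidth, width_smul hρ, mul_div_assoc, Real.mul_iInf_of_nonneg hρ]

theorem minRelWidth_vadd (hS : IsCompact S) (x : E d) :
    minRelWidth C (x +ᵥ S) = minRelWidth C S := by
  simp only [minRelWidth, relWidth, width_vadd hS]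

theorem minRelWidth_mono (hC : IsCompact C) (hT : IsCompact T) (hS : IsCompact S) (hST : S ⊆ T) :
    minRelWidth C S ≤ minRelWidth C T :=
  ciInf_mono (bddBelow_range_relWidth hC hS) fun u =>
    div_le_div_of_nonneg_right (width_mono hT hST) (width_nonneg hC u)

variable [Nonempty (UnitVec d)]

theorem exists_relWidth_eq_minRelWidth (hC : IsConvexBody C) (hL : IsCompact L) :
    ∃ u : UnitVec d, relWidth C L u = minRelWidth C L := by
  have hcont : Continuous (relWidth C L) :=
    (continuous_width hL).div (continuous_width hC.isCompact) fun u => (hC.width_pos u).ne'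
  exact (isCompact_range hcont).sInf_mem (range_nonempty _)

theorem exists_width_eq_minRelWidth_mul (hC : IsConvexBody C) (hL : IsCompact L) :
    ∃ u : UnitVec d, width L u = minRelWidth C L * width C u := by
  obtain ⟨u, hu⟩ := exists_relWidth_eq_minRelWidth hC hL
  exact ⟨u, (div_eq_iff (hC.width_pos u).ne').1 hu⟩

theorem le_minRelWidth (hC : IsConvexBody C) {a : ℝ} (h : ∀ u, a * width C u ≤ width L u) :
    a ≤ minRelWidth C L :=
  le_ciInf fun u => (le_div_iff₀ (hC.width_pos u)).2 (h u)

theorem minRelWidth_pos (hC : IsConvexBody C) (hL : IsConvexBody L) : 0 < minRelWidth C L := by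
  obtain ⟨u, hu⟩ := exists_relWidth_eq_minRelWidth hC hL.isCompact
  exact hu ▸ div_pos (hL.width_pos u) (hC.width_pos u)

theorem minRelWidth_add_le (hC : IsCompact C) (hS : IsCompact S) (hS₀ : S.Nonempty)
    (hT : IsCompact T) (hT₀ : T.Nonempty) :
    minRelWidth C S + minRelWidth C T ≤ minRelWidth C (S + T) :=
  le_ciInf fun u => by
    rw [relWidth, width_add hS hS₀ hT hT₀, add_div]
    exact add_le_add (ciInf_le (bddBelow_range_relWidth hC hS) u)
      (ciInf_le (bddBelow_range_relWidth hC hT) u)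

theorem minRelWidth_add_smul_self (hC : IsConvexBody C) (hS : IsCompact S) (hS₀ : S.Nonempty)
    (hρ : 0 ≤ ρ) : minRelWidth C (S + ρ • C) = minRelWidth C S + ρ := by
  have hrel : ∀ u, relWidth C (S + ρ • C) u = relWidth C S u + ρ := fun u => by
    rw [relWidth, width_add hS hS₀ (hC.isCompact.smul ρ) hC.nonempty.smul_set, width_smul hρ,
      add_div, mul_div_cancel_right₀ _ (hC.width_pos u).ne', relWidth]
  simp only [minRelWidth, hrel]
  exact (ciInf_add (bddBelow_range_relWidth hC.isCompact hS) ρ).symm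

end MinRelWidth

section Erosion

variable {d : ℕ} {C L S : Set (E d)} {ρ σ : ℝ}

/-- The erosion (Minkowski difference) `L ⊖ ρC`, encoded as the set of translation vectors `t`
with `t + ρC ⊆ L`. Its minimal `C`-width is that of the rounded body minus `ρ`. -/
def erosion (C L : Set (E d)) (ρ : ℝ) : Set (E d) :=
  {t | homothet t ρ C ⊆ L}

theorem mem_erosion_iff {t : E d} : t ∈ erosion C L ρ ↔ ∀ c ∈ C, t + ρ • c ∈ L :=
  image_subset_iff

theorem erosion_zero (hC : C.Nonempty) : erosion C L 0 = L := by
  simp [erosion, homothet, hC.image_const]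

theorem roundedBody_eq_erosion_add_smul : roundedBody C L ρ = erosion C L ρ + ρ • C := by
  rw [← iUnion_add_left_image]
  simp only [roundedBody, homothet, ← image_smul, image_image]
  rfl

theorem roundedBody_subset : roundedBody C L ρ ⊆ L :=
  iUnion₂_subset fun _ ht => ht

theorem roundedBody_mono (hSL : S ⊆ L) : roundedBody C S ρ ⊆ roundedBody C L ρ :=
  biUnion_subset_biUnion_left fun _ ht => Subset.trans ht hSL

theorem roundedBody_nonempty (hC : C.Nonempty) (hne : (erosion C L ρ).Nonempty) :
    (roundedBody C L ρ).Nonempty := by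
  rw [roundedBody_eq_erosion_add_smul]
  exact hne.add hC.smul_set

theorem smul_erosion_add_smul_erosion_subset (hL : Convex ℝ L) {a b : ℝ} (ha : 0 ≤ a) (hb : 0 ≤ b)
    (hab : a + b = 1) :
    a • erosion C L ρ + b • erosion C L σ ⊆ erosion C L (a * ρ + b * σ) := by
  rintro _ ⟨_, ⟨s, hs, rfl⟩, _, ⟨t, ht, rfl⟩, rfl⟩
  rw [mem_erosion_iff] at *
  intro c hc
  convert hL (hs c hc) (ht c hc) ha hb hab using 1
  module

theorem convex_erosion (hL : Convex ℝ L) : Convex ℝ (erosion C L ρ) :=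
  convex_iff_pointwise_add_subset.2 fun a b ha hb hab => by
    simpa only [← add_mul, hab, one_mul] using
      smul_erosion_add_smul_erosion_subset (ρ := ρ) (σ := ρ) hL ha hb hab

theorem erosion_erosion_subset : erosion C (erosion C L ρ) σ ⊆ erosion C L (ρ + σ) := by
  intro t ht
  rw [mem_erosion_iff] at *
  intro c hc
  convert mem_erosion_iff.1 (ht c hc) c hc using 1
  module

theorem erosion_add_smul_subset (hC : Convex ℝ C) (hρ : 0 ≤ ρ) (hρσ : ρ ≤ σ) :
    erosion C L σ + (σ - ρ) • C ⊆ erosion C L ρ := by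
  rintro _ ⟨t, ht, _, ⟨c, hc, rfl⟩, rfl⟩
  rw [mem_erosion_iff] at *
  intro c' hc'
  obtain ⟨c'', hc'', h⟩ := hC.exists_mem_add_smul_eq hc hc' (sub_nonneg.2 hρσ) hρ
  rw [sub_add_cancel] at h
  simpa only [add_assoc, h] using ht c'' hc''

theorem erosion_nonempty_of_le (hC : Convex ℝ C) (hC₀ : C.Nonempty) (hρ : 0 ≤ ρ) (hρσ : ρ ≤ σ)
    (hσ : (erosion C L σ).Nonempty) : (erosion C L ρ).Nonempty :=
  (hσ.add hC₀.smul_set).mono (erosion_add_smul_subset hC hρ hρσ)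

theorem isClosed_setOf_mem_erosion (hL : IsClosed L) :
    IsClosed {p : ℝ × E d | p.2 ∈ erosion C L p.1} := by
  simp only [mem_erosion_iff, ofPred_forall]
  exact isClosed_biInter fun c _ => hL.preimage (by fun_prop)

theorem isCompact_erosion (hC : C.Nonempty) (hL : IsCompact L) : IsCompact (erosion C L ρ) := by
  obtain ⟨c, hc⟩ := hC
  refine (hL.vadd (-(ρ • c))).of_isClosed_subset
    ((isClosed_setOf_mem_erosion hL.isClosed).preimage (Continuous.prodMk_right ρ)) fun x hx => ?_
  exact ⟨x + ρ • c, mem_erosion_iff.1 hx c hc, by simp⟩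

theorem isCompact_roundedBody (hC : IsCompact C) (hC₀ : C.Nonempty) (hL : IsCompact L) :
    IsCompact (roundedBody C L ρ) :=
  roundedBody_eq_erosion_add_smul ▸ (isCompact_erosion hC₀ hL).add (hC.smul ρ)

theorem nonempty_erosion_of_interior_nonempty (hC : IsCompact C) (hS : (interior S).Nonempty) :
    ∃ ε > 0, (erosion C S ε).Nonempty := by
  obtain ⟨x, hx⟩ := hS
  have hsmall : ∀ᶠ ε : ℝ in 𝓝 0, x +ᵥ ε • C ⊆ S := by
    have hnhds : {y | x + y ∈ S} ∈ 𝓝 (0 : E d) :=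
      (continuous_const_add x).continuousAt.preimage_mem_nhds
        (by simpa using mem_interior_iff_mem_nhds.1 hx)
    filter_upwards [((hC.isVonNBounded ℝ).tendsto_smallSets_nhds).eventually
      (eventually_smallSets_subset.2 hnhds)] with ε hε
    exact vadd_set_subset_iff.2 fun y hy => hε hy
  obtain ⟨ε, hε, h⟩ := hsmall.exists_gt
  exact ⟨ε, hε, x, mem_erosion_iff.2 fun c hc => h (vadd_mem_vadd_set (smul_mem_smul_set hc))⟩

theorem interior_nonempty_of_width_ne_zero (hS : Convex ℝ S) (hS₀ : S.Nonempty)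
    (h : ∀ u, width S u ≠ 0) : (interior S).Nonempty := by
  rw [hS.interior_nonempty_iff_affineSpan_eq_top,
    AffineSubspace.affineSpan_eq_top_iff_vectorSpan_eq_top_of_nonempty ℝ _ _ hS₀]
  by_contra htop
  obtain ⟨v, hv, hv₀⟩ := Submodule.exists_mem_ne_zero_of_ne_bot
    (mt Submodule.orthogonal_eq_bot_iff.1 htop)
  let u : UnitVec d := ⟨‖v‖⁻¹ • v, by simp [norm_smul, hv₀]⟩
  have hu : (u : E d) ∈ (vectorSpan ℝ S)ᗮ := Submodule.smul_mem _ _ hv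
  obtain ⟨x, hx⟩ := hS₀
  have himage : (fun y : E d => inner ℝ (u : E d) y) '' S = {inner ℝ (u : E d) x} := by
    refine eq_singleton_iff_unique_mem.2 ⟨mem_image_of_mem _ hx, forall_mem_image.2 fun y hy => ?_⟩
    rw [← sub_eq_zero, ← inner_sub_right]
    exact Submodule.inner_left_of_mem_orthogonal (vsub_mem_vectorSpan ℝ hy hx) hu
  exact h u (by simp only [width, upperLevel, lowerLevel, himage, csSup_singleton,
    csInf_singleton, sub_self])

end Erosion

section ErosionWidth

variable {d : ℕ} {C L : Set (E d)} {ρ σ κ : ℝ} [Nonempty (UnitVec d)]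

theorem minRelWidth_roundedBody (hC : IsConvexBody C) (hL : IsCompact L)
    (hρ : 0 ≤ ρ) (hne : (erosion C L ρ).Nonempty) :
    minRelWidth C (roundedBody C L ρ) = minRelWidth C (erosion C L ρ) + ρ := by
  rw [roundedBody_eq_erosion_add_smul,
    minRelWidth_add_smul_self hC (isCompact_erosion hC.nonempty hL) hne hρ]

theorem minRelWidth_erosion_add_sub_le (hC : IsConvexBody C) (hL : IsCompact L) (hρ : 0 ≤ ρ)
    (hρσ : ρ ≤ σ) (hne : (erosion C L σ).Nonempty) :
    minRelWidth C (erosion C L σ) + (σ - ρ) ≤ minRelWidth C (erosion C L ρ) := by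
  have hE := isCompact_erosion (ρ := σ) hC.nonempty hL
  rw [← minRelWidth_add_smul_self hC hE hne (sub_nonneg.2 hρσ)]
  exact minRelWidth_mono hC.isCompact (isCompact_erosion hC.nonempty hL)
    (hE.add (hC.isCompact.smul _)) (erosion_add_smul_subset hC.convex hρ hρσ)

theorem le_minRelWidth_of_erosion_nonempty (hC : IsConvexBody C) (hL : IsCompact L) (hρ : 0 ≤ ρ)
    (hne : (erosion C L ρ).Nonempty) : ρ ≤ minRelWidth C L := by
  have h := minRelWidth_erosion_add_sub_le hC hL le_rfl hρ hne
  rw [erosion_zero hC.nonempty, sub_zero] at h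
  linarith [minRelWidth_nonneg hC.isCompact (isCompact_erosion (ρ := ρ) hC.nonempty hL)]

theorem minRelWidth_erosion_concave (hC : IsConvexBody C) (hL : IsCompact L) (hL' : Convex ℝ L)
    (hρ : (erosion C L ρ).Nonempty) (hσ : (erosion C L σ).Nonempty) {a b : ℝ} (ha : 0 ≤ a)
    (hb : 0 ≤ b) (hab : a + b = 1) :
    a * minRelWidth C (erosion C L ρ) + b * minRelWidth C (erosion C L σ) ≤
      minRelWidth C (erosion C L (a * ρ + b * σ)) := by
  have hE (τ : ℝ) : IsCompact (erosion C L τ) := isCompact_erosion hC.nonempty hL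
  calc a * minRelWidth C (erosion C L ρ) + b * minRelWidth C (erosion C L σ)
      = minRelWidth C (a • erosion C L ρ) + minRelWidth C (b • erosion C L σ) := by
        rw [minRelWidth_smul ha, minRelWidth_smul hb]
    _ ≤ minRelWidth C (a • erosion C L ρ + b • erosion C L σ) :=
        minRelWidth_add_le hC.isCompact ((hE ρ).smul a) hρ.smul_set ((hE σ).smul b) hσ.smul_set
    _ ≤ minRelWidth C (erosion C L (a * ρ + b * σ)) :=
        minRelWidth_mono hC.isCompact (hE _) (((hE ρ).smul a).add ((hE σ).smul b))
          (smul_erosion_add_smul_erosion_subset hL' ha hb hab)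

theorem isCompact_setOf_mul_le_width_erosion (hC : IsConvexBody C) (hL : IsCompact L) (κ : ℝ)
    (u : UnitVec d) :
    IsCompact {ρ | 0 ≤ ρ ∧ (erosion C L ρ).Nonempty ∧ κ * ρ ≤ width (erosion C L ρ) u} := by
  obtain ⟨c, hc⟩ := hC.nonempty
  let Z : Set (ℝ × E d × E d) := {p | 0 ≤ p.1 ∧ p.2.1 ∈ erosion C L p.1 ∧
    p.2.2 ∈ erosion C L p.1 ∧ κ * p.1 ≤ inner ℝ (u : E d) p.2.1 - inner ℝ (u : E d) p.2.2}
  have hclosed : IsClosed Z :=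
    (isClosed_le continuous_const continuous_fst).inter <|
      ((isClosed_setOf_mem_erosion hL.isClosed).preimage
        (f := fun p : ℝ × E d × E d => (p.1, p.2.1)) (by fun_prop)).inter <|
      ((isClosed_setOf_mem_erosion hL.isClosed).preimage
        (f := fun p : ℝ × E d × E d => (p.1, p.2.2)) (by fun_prop)).inter <|
      isClosed_le (f := fun p : ℝ × E d × E d => κ * p.1)
        (g := fun p => inner ℝ (u : E d) p.2.1 - inner ℝ (u : E d) p.2.2)
        (by fun_prop) (by fun_prop)
  have hbounded : Z ⊆ (fun p : ℝ × E d × E d => (p.1, p.2.1 - p.1 • c, p.2.2 - p.1 • c)) ''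
      (Icc 0 (minRelWidth C L) ×ˢ L ×ˢ L) := by
    rintro ⟨ρ, x, y⟩ ⟨hρ, hx, hy, -⟩
    exact ⟨(ρ, x + ρ • c, y + ρ • c),
      ⟨⟨hρ, le_minRelWidth_of_erosion_nonempty hC hL hρ ⟨x, hx⟩⟩,
        mem_erosion_iff.1 hx c hc, mem_erosion_iff.1 hy c hc⟩, by simp⟩
  have hZ : IsCompact Z :=
    ((isCompact_Icc.prod (hL.prod hL)).image (by fun_prop)).of_isClosed_subset hclosed hbounded
  convert hZ.image continuous_fst using 1
  have hE (ρ : ℝ) : IsCompact (erosion C L ρ) := isCompact_erosion ⟨c, hc⟩ hL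
  ext ρ
  constructor
  · rintro ⟨hρ, hne, hle⟩
    obtain ⟨x, hx, y, hy, hxy⟩ := exists_inner_sub_inner_eq_width (hE ρ) hne u
    exact ⟨(ρ, x, y), ⟨hρ, hx, hy, hle.trans_eq hxy.symm⟩, rfl⟩
  · rintro ⟨⟨ρ, x, y⟩, ⟨hρ, hx, hy, hle⟩, rfl⟩
    exact ⟨hρ, ⟨x, hx⟩, hle.trans (inner_sub_inner_le_width (hE ρ) hx hy)⟩

theorem isCompact_setOf_mul_le_minRelWidth_erosion (hC : IsConvexBody C) (hL : IsCompact L)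
    (κ : ℝ) :
    IsCompact {ρ | 0 ≤ ρ ∧ (erosion C L ρ).Nonempty ∧ κ * ρ ≤ minRelWidth C (erosion C L ρ)} := by
  have hA (u : UnitVec d) := isCompact_setOf_mul_le_width_erosion hC hL (κ * width C u) u
  convert (hA (Classical.arbitrary _)).of_isClosed_subset (isClosed_iInter fun u => (hA u).isClosed)
    (iInter_subset _ _) using 1
  ext ρ
  simp only [mem_iInter, mem_ofPred_eq, forall_and, forall_const, mul_right_comm κ]
  refine and_congr_right fun _ => and_congr_right fun _ => ⟨fun h u => ?_, le_minRelWidth hC⟩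
  exact (mul_le_mul_of_nonneg_right h (hC.width_pos u).le).trans
    (minRelWidth_mul_width_le hC (isCompact_erosion hC.nonempty hL) u)

theorem exists_gt_mul_le_minRelWidth_erosion (hC : IsConvexBody C) (hL : IsCompact L)
    (hL' : Convex ℝ L) (hκ : 0 ≤ κ) (hρ : 0 ≤ ρ) (h : κ * ρ < minRelWidth C (erosion C L ρ)) :
    ∃ σ > ρ, (erosion C L σ).Nonempty ∧ κ * σ ≤ minRelWidth C (erosion C L σ) := by
  have hE (τ : ℝ) : IsCompact (erosion C L τ) := isCompact_erosion hC.nonempty hL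
  have hpos : 0 < minRelWidth C (erosion C L ρ) := (mul_nonneg hκ hρ).trans_lt h
  have hne : (erosion C L ρ).Nonempty := nonempty_of_minRelWidth_pos hpos
  obtain ⟨ε, hε, hεne⟩ := nonempty_erosion_of_interior_nonempty hC.isCompact <|
    interior_nonempty_of_width_ne_zero (convex_erosion hL') hne fun u =>
      ((mul_pos hpos (hC.width_pos u)).trans_le (minRelWidth_mul_width_le hC (hE ρ) u)).ne'
  have hlim : ∀ᶠ l : ℝ in 𝓝 0, κ * ((1 - l) * ρ + l * (ρ + ε)) <
      (1 - l) * minRelWidth C (erosion C L ρ) :=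
    ContinuousAt.eventually_lt (by fun_prop) (by fun_prop) (by simpa using h)
  obtain ⟨l, hl₀, hl, hl₁⟩ := (hlim.and (eventually_le_nhds zero_lt_one)).exists_gt
  have hερ := hεne.mono erosion_erosion_subset
  refine ⟨(1 - l) * ρ + l * (ρ + ε), by nlinarith, ?_, hl.le.trans ?_⟩
  · exact (hne.smul_set.add hερ.smul_set).mono
      (smul_erosion_add_smul_erosion_subset hL' (sub_nonneg.2 hl₁) hl₀.le (sub_add_cancel 1 l))
  · refine le_trans ?_ (minRelWidth_erosion_concave hC hL hL' hne hερ (sub_nonneg.2 hl₁) hl₀.le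
      (sub_add_cancel 1 l))
    exact le_add_of_nonneg_right (mul_nonneg hl₀.le (minRelWidth_nonneg hC.isCompact (hE _)))

end ErosionWidth

section SuccessiveInradius

variable {d : ℕ} {C L : Set (E d)} {ρ r κ : ℝ} {k : ℕ} [Nonempty (UnitVec d)]

theorem le_inradius_iff (hC : IsConvexBody C) (hL : IsCompact L) (hρ : 0 < ρ) :
    ρ ≤ inradius C L ↔ (erosion C L ρ).Nonempty := by
  have hE (σ : ℝ) := minRelWidth_nonneg hC.isCompact (isCompact_erosion (ρ := σ) hC.nonempty hL)
  refine ⟨fun h => ?_, fun h => le_csSup ⟨minRelWidth C L, fun σ hσ =>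
    le_minRelWidth_of_erosion_nonempty hC hL hσ.1.le hσ.2⟩ ⟨hρ, h⟩⟩
  have hne : {σ : ℝ | 0 < σ ∧ (erosion C L σ).Nonempty}.Nonempty := by
    by_contra! hempty
    exact (hρ.trans_le h).ne' ((congrArg sSup hempty).trans Real.sSup_empty)
  have hA := isCompact_setOf_mul_le_minRelWidth_erosion hC hL 0
  simp only [zero_mul, hE, and_true] at hA
  obtain ⟨τ, ⟨-, hτ⟩, hmax⟩ := hA.exists_isGreatest (hne.imp fun σ hσ => ⟨hσ.1.le, hσ.2⟩)
  exact erosion_nonempty_of_le hC.convex hC.nonempty hρ.le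
    (h.trans (csSup_le hne fun σ hσ => hmax ⟨hσ.1.le, hσ.2⟩)) hτ

theorem isSuccessiveInradius_iff (hC : IsConvexBody C) (hL : IsCompact L) :
    IsSuccessiveInradius C L k ρ ↔
      0 < ρ ∧ (erosion C L ρ).Nonempty ∧ minRelWidth C (erosion C L ρ) + ρ = k * ρ := by
  refine and_congr_right fun hρ => ?_
  rw [le_inradius_iff hC hL hρ]
  exact and_congr_right fun h => by rw [minRelWidth_roundedBody hC hL hρ.le h]

theorem exists_minRelWidth_erosion_eq (hC : IsConvexBody C) (hL : IsConvexBody L) (hκ : 0 ≤ κ) :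
    ∃ ρ > 0, (erosion C L ρ).Nonempty ∧ minRelWidth C (erosion C L ρ) = κ * ρ := by
  have hzero : κ * 0 < minRelWidth C (erosion C L 0) := by
    simpa only [mul_zero, erosion_zero hC.nonempty] using minRelWidth_pos hC hL
  obtain ⟨σ, hσ, hσne, hσle⟩ :=
    exists_gt_mul_le_minRelWidth_erosion hC hL.isCompact hL.convex hκ le_rfl hzero
  obtain ⟨ρ, ⟨hρ, hne, hle⟩, hmax⟩ :=
    (isCompact_setOf_mul_le_minRelWidth_erosion hC hL.isCompact κ).exists_isGreatest
      ⟨σ, hσ.le, hσne, hσle⟩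
  refine ⟨ρ, hσ.trans_le (hmax ⟨hσ.le, hσne, hσle⟩), hne, hle.antisymm' ?_⟩
  by_contra! hlt
  obtain ⟨τ, hτ, hτne, hτle⟩ :=
    exists_gt_mul_le_minRelWidth_erosion hC hL.isCompact hL.convex hκ hρ hlt
  exact hτ.not_ge (hmax ⟨hρ.trans hτ.le, hτne, hτle⟩)

theorem IsSuccessiveInradius.minRelWidth_erosion_add_le (hC : IsConvexBody C) (hL : IsCompact L)
    (hk : 1 ≤ k) (h : IsSuccessiveInradius C L k r) (hrρ : r ≤ ρ) :
    minRelWidth C (erosion C L ρ) + ρ ≤ k * ρ := by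
  obtain ⟨hr, -, heq⟩ := (isSuccessiveInradius_iff hC hL).1 h
  have hk' : (1 : ℝ) ≤ k := mod_cast hk
  rcases (erosion C L ρ).eq_empty_or_nonempty with hempty | hne
  · rw [hempty, minRelWidth_empty, zero_add]
    exact le_mul_of_one_le_left (hr.le.trans hrρ) hk'
  · nlinarith [minRelWidth_erosion_add_sub_le hC hL hr.le hrρ hne]

theorem IsSuccessiveInradius.lt_minRelWidth_erosion_add (hC : IsConvexBody C) (hL : IsCompact L)
    (hk : 1 ≤ k) (h : IsSuccessiveInradius C L k r) (hρ : 0 ≤ ρ) (hρr : ρ < r) :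
    k * ρ < minRelWidth C (erosion C L ρ) + ρ := by
  obtain ⟨-, hne, heq⟩ := (isSuccessiveInradius_iff hC hL).1 h
  have hk' : (1 : ℝ) ≤ k := mod_cast hk
  nlinarith [minRelWidth_erosion_add_sub_le hC hL hρ hρr.le hne]

theorem IsSuccessiveInradius.le (hC : IsConvexBody C) (hL : IsCompact L) (hk : 1 ≤ k)
    (h : IsSuccessiveInradius C L k r) (hρ : IsSuccessiveInradius C L k ρ) : r ≤ ρ := by
  by_contra! hlt
  exact (h.lt_minRelWidth_erosion_add hC hL hk hρ.1.le hlt).ne'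
    ((isSuccessiveInradius_iff hC hL).1 hρ).2.2

theorem existsUnique_isSuccessiveInradius (hC : IsConvexBody C) (hL : IsConvexBody L)
    (hk : 1 ≤ k) : ∃! ρ, IsSuccessiveInradius C L k ρ := by
  obtain ⟨ρ, hρ, hne, heq⟩ :=
    exists_minRelWidth_erosion_eq hC hL (sub_nonneg.2 (Nat.one_le_cast (α := ℝ).2 hk))
  have h : IsSuccessiveInradius C L k ρ :=
    (isSuccessiveInradius_iff hC hL.isCompact).2 ⟨hρ, hne, by rw [heq]; ring⟩
  exact ⟨ρ, h, fun σ hσ => (hσ.le hC hL.isCompact hk h).antisymm (h.le hC hL.isCompact hk hσ)⟩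

theorem isSuccessiveInradius_successiveInradius (hC : IsConvexBody C) (hL : IsConvexBody L)
    (hk : 1 ≤ k) : IsSuccessiveInradius C L k (successiveInradius C L k) := by
  obtain ⟨ρ, hρ, huniq⟩ := existsUnique_isSuccessiveInradius hC hL hk
  have hset : {σ | IsSuccessiveInradius C L k σ} = {ρ} :=
    eq_singleton_iff_unique_mem.2 ⟨hρ, huniq⟩
  rwa [successiveInradius, hset, csSup_singleton]

end SuccessiveInradius

section TwoPlanks

variable {V : Type*} [AddCommGroup V] [Module ℝ V] {T : Set V} {f g : V →ₗ[ℝ] ℝ} {a b a' b' : ℝ}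
  {A B D U : V}

theorem mul_posPart_le_mul_posPart_of_avoids_quadrant (hT : Convex ℝ T)
    (hcov : ∀ x ∈ T, a ≤ f x ∨ b ≤ g x) (hA : A ∈ T) (hD : D ∈ T) :
    (a - f A)⁺ * (b - g D)⁺ ≤ (g A - b)⁺ * (f D - a)⁺ := by
  have hnonneg : 0 ≤ (g A - b)⁺ * (f D - a)⁺ := mul_nonneg (posPart_nonneg _) (posPart_nonneg _)
  rcases le_or_gt a (f A) with hfA | hfA
  · rwa [posPart_of_nonpos (sub_nonpos.2 hfA), zero_mul]
  rcases le_or_gt b (g D) with hgD | hgD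
  · rwa [posPart_of_nonpos (sub_nonpos.2 hgD), mul_zero]
  have hgA : b ≤ g A := (hcov A hA).resolve_left hfA.not_ge
  have hfD : a ≤ f D := (hcov D hD).resolve_right hgD.not_ge
  rw [posPart_of_nonneg (sub_nonneg.2 hfA.le), posPart_of_nonneg (sub_nonneg.2 hgD.le),
    posPart_of_nonneg (sub_nonneg.2 hgA), posPart_of_nonneg (sub_nonneg.2 hfD)]
  by_contra! hlt
  have hf : 0 < f D - f A := sub_pos.2 (hfA.trans_le hfD)
  have hg : 0 < g A - g D := sub_pos.2 (hgD.trans_le hgA)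
  -- the segment from `A` to `D` crosses `g = b` before it crosses `f = a`
  obtain ⟨s, hs_gt, hs_lt⟩ : ∃ s, (g A - b) / (g A - g D) < s ∧ s < (a - f A) / (f D - f A) :=
    exists_between ((div_lt_div_iff₀ hg hf).2 (by linarith))
  have hs₀ : 0 ≤ s := (div_nonneg (sub_nonneg.2 hgA) hg.le).trans hs_gt.le
  have hs₁ : s ≤ 1 := hs_lt.le.trans ((div_le_one hf).2 (by linarith))
  rw [div_lt_iff₀ hg] at hs_gt
  rw [lt_div_iff₀ hf] at hs_lt
  have hcov_s := hcov _ (hT hA hD (sub_nonneg.2 hs₁) hs₀ (sub_add_cancel 1 s))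
  simp only [map_add, map_smul, smul_eq_mul] at hcov_s
  rcases hcov_s with h | h <;> linarith

theorem mul_add_sq_le_of_mul_le_mul {p q r x y y' z : ℝ} (hp : 0 ≤ p) (hq : 0 ≤ q) (hr : 0 ≤ r)
    (hx : 0 ≤ x) (hz : 0 ≤ z) (hy : 0 ≤ y) (hy' : 0 ≤ y') (h : p * r ≤ y * x)
    (h' : q * r ≤ y' * z) : r * (p + q) ^ 2 ≤ (x + z) * (p * y + q * y') := by
  have hsq : ∀ {s t v : ℝ}, 0 ≤ s → s * r ≤ t * v → (√r * s) ^ 2 ≤ v * (s * t) := fun hs ht => by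
    rw [mul_pow, Real.sq_sqrt hr]; nlinarith
  have hcs := Finset.sum_sq_le_sum_mul_sum_of_sq_le_mul Finset.univ (r := ![√r * p, √r * q])
    (f := ![x, z]) (g := ![p * y, q * y'])
    (by simp [Fin.forall_fin_two, hx, hz])
    (by simp [Fin.forall_fin_two, mul_nonneg hp hy, mul_nonneg hq hy'])
    (by simp only [Finset.mem_univ, forall_const, Fin.forall_fin_two]
        exact ⟨hsq hp h, hsq hq h'⟩)
  simpa [← mul_add, mul_pow, Real.sq_sqrt hr] using hcs

theorem posPart_mul_add_sq_le_of_slab_or_halfSpace (hT : Convex ℝ T) (hab : a ≤ b)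
    (hcov : ∀ x ∈ T, f x ∈ Icc a b ∨ a' ≤ g x) (hA : A ∈ T) (hB : B ∈ T) (hD : D ∈ T) :
    (a' - g D)⁺ * ((a - f A)⁺ + (f B - b)⁺) ^ 2 ≤
      (b - a) * ((a - f A)⁺ * (g A - a')⁺ + (f B - b)⁺ * (g B - a')⁺) := by
  rcases le_or_gt a' (g D) with hgD | hgD
  · rw [posPart_of_nonpos (sub_nonpos.2 hgD), zero_mul]
    have := sub_nonneg.2 hab
    positivity
  obtain ⟨hfaD, hfDb⟩ : f D ∈ Icc a b := (hcov D hD).resolve_right hgD.not_ge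
  have hlower := mul_posPart_le_mul_posPart_of_avoids_quadrant hT
    (fun x hx => (hcov x hx).imp_left And.left) hA hD
  have hupper := mul_posPart_le_mul_posPart_of_avoids_quadrant (f := -f) (a := -b) hT
    (fun x hx => (hcov x hx).imp_left fun h => neg_le_neg h.2) hB hD
  simp only [LinearMap.neg_apply, neg_sub_neg] at hupper
  have h := mul_add_sq_le_of_mul_le_mul (posPart_nonneg _) (posPart_nonneg _) (posPart_nonneg _)
    (posPart_nonneg _) (posPart_nonneg _) (posPart_nonneg _) (posPart_nonneg _) hlower hupper
  rwa [posPart_of_nonneg (sub_nonneg.2 hfaD), posPart_of_nonneg (sub_nonneg.2 hfDb),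
    sub_add_sub_cancel'] at h

theorem posPart_mul_add_eq_of_slab_or_slab
    (hcov : ∀ x ∈ T, a ≤ f x ∨ g x ∈ Icc a' b') (hA : A ∈ T) :
    (a - f A)⁺ * ((g A - a')⁺ + (b' - g A)⁺) = (a - f A)⁺ * (b' - a') := by
  rcases le_or_gt a (f A) with hfA | hfA
  · rw [posPart_of_nonpos (sub_nonpos.2 hfA), zero_mul, zero_mul]
  obtain ⟨h, h'⟩ : g A ∈ Icc a' b' := (hcov A hA).resolve_left hfA.not_ge
  rw [posPart_of_nonneg (sub_nonneg.2 h), posPart_of_nonneg (sub_nonneg.2 h'),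
    sub_add_sub_cancel']

theorem posPart_add_mul_posPart_add_le_of_subset_two_slabs (hT : Convex ℝ T) (hab : a ≤ b)
    (hab' : a' ≤ b') (hcov : ∀ x ∈ T, f x ∈ Icc a b ∨ g x ∈ Icc a' b') (hA : A ∈ T) (hB : B ∈ T)
    (hD : D ∈ T) (hU : U ∈ T) :
    ((a - f A)⁺ + (f B - b)⁺) * ((a' - g D)⁺ + (g U - b')⁺) ≤ (b - a) * (b' - a') := by
  have hlower := posPart_mul_add_sq_le_of_slab_or_halfSpace hT hab
    (fun x hx => (hcov x hx).imp_right And.left) hA hB hD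
  have hupper := posPart_mul_add_sq_le_of_slab_or_halfSpace (g := -g) (a' := -b') hT hab
    (fun x hx => (hcov x hx).imp_right fun h => neg_le_neg h.2) hA hB hU
  have hA' := posPart_mul_add_eq_of_slab_or_slab (fun x hx => (hcov x hx).imp_left And.left) hA
  have hB' := posPart_mul_add_eq_of_slab_or_slab (f := -f) (a := -b)
    (fun x hx => (hcov x hx).imp_left fun h => neg_le_neg h.2) hB
  simp only [LinearMap.neg_apply, neg_sub_neg] at hupper hB'
  rcases (add_nonneg (posPart_nonneg (a - f A)) (posPart_nonneg (f B - b))).eq_or_lt' with h | h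
  · rw [h, zero_mul]
    exact mul_nonneg (sub_nonneg.2 hab) (sub_nonneg.2 hab')
  · refine le_of_mul_le_mul_left ?_ h
    linear_combination hlower + hupper + (b - a) * (hA' + hB')

/-- Bang's affine plank inequality for two planks. -/
theorem mul_le_add_of_subset_two_slabs (hT : Convex ℝ T) (hab : a ≤ b) (hab' : a' ≤ b')
    (hcov : ∀ x ∈ T, f x ∈ Icc a b ∨ g x ∈ Icc a' b') (hA : A ∈ T) (hB : B ∈ T) (hD : D ∈ T)
    (hU : U ∈ T) (hAB : f A ≤ f B) (hDU : g D ≤ g U) :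
    (f B - f A) * (g U - g D) ≤ (b - a) * (g U - g D) + (b' - a') * (f B - f A) := by
  rcases le_or_gt (f B - f A) (b - a) with hf | -
  · nlinarith [mul_le_mul_of_nonneg_right hf (sub_nonneg.2 hDU),
      mul_nonneg (sub_nonneg.2 hab') (sub_nonneg.2 hAB)]
  rcases le_or_gt (g U - g D) (b' - a') with hg | hg
  · nlinarith [mul_le_mul_of_nonneg_right hg (sub_nonneg.2 hAB),
      mul_nonneg (sub_nonneg.2 hab) (sub_nonneg.2 hDU)]
  have hexcess : (f B - f A - (b - a)) * (g U - g D - (b' - a')) ≤ (b - a) * (b' - a') :=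
    (mul_le_mul (by linarith [le_posPart (a - f A), le_posPart (f B - b)])
      (by linarith [le_posPart (a' - g D), le_posPart (g U - b')]) (sub_nonneg.2 hg.le)
      (by positivity)).trans
    (posPart_add_mul_posPart_add_le_of_subset_two_slabs hT hab hab' hcov hA hB hD hU)
  linarith

end TwoPlanks

section Subadditivity

variable {d : ℕ} {C S S₁ S₂ T : Set (E d)} {ρ : ℝ}

theorem width_mul_width_le_of_subset_union (hT : IsCompact T) (hT' : Convex ℝ T) (hT₀ : T.Nonempty)
    (hS₁ : IsCompact S₁) (hS₂ : IsCompact S₂) (hTS : T ⊆ S₁ ∪ S₂) (u₁ u₂ : UnitVec d) :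
    width T u₁ * width T u₂ ≤ width S₁ u₁ * width T u₂ + width S₂ u₂ * width T u₁ := by
  obtain ⟨B, hB, A, hA, hAB⟩ := exists_inner_sub_inner_eq_width hT hT₀ u₁
  obtain ⟨U, hU, D, hD, hDU⟩ := exists_inner_sub_inner_eq_width hT hT₀ u₂
  have hcov : ∀ x ∈ T, innerₛₗ ℝ (u₁ : E d) x ∈ Icc (lowerLevel S₁ u₁) (upperLevel S₁ u₁) ∨
      innerₛₗ ℝ (u₂ : E d) x ∈ Icc (lowerLevel S₂ u₂) (upperLevel S₂ u₂) := fun x hx =>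
    (hTS hx).imp (fun h => ⟨lowerLevel_le_inner hS₁ h, inner_le_upperLevel hS₁ h⟩)
      fun h => ⟨lowerLevel_le_inner hS₂ h, inner_le_upperLevel hS₂ h⟩
  have hplanks := mul_le_add_of_subset_two_slabs hT' (sub_nonneg.1 (width_nonneg hS₁ u₁))
    (sub_nonneg.1 (width_nonneg hS₂ u₂)) hcov hA hB hD hU
    (sub_nonneg.1 (hAB ▸ width_nonneg hT u₁)) (sub_nonneg.1 (hDU ▸ width_nonneg hT u₂))
  simp only [innerₛₗ_apply_apply, hAB, hDU] at hplanks
  exact hplanks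

theorem minRelWidth_le_add_of_subset_union [Nonempty (UnitVec d)] (hC : IsConvexBody C)
    (hT : IsCompact T) (hT' : Convex ℝ T) (hS₁ : IsCompact S₁) (hS₂ : IsCompact S₂)
    (hTS : T ⊆ S₁ ∪ S₂) : minRelWidth C T ≤ minRelWidth C S₁ + minRelWidth C S₂ := by
  have hw₁ := minRelWidth_nonneg hC.isCompact hS₁
  have hw₂ := minRelWidth_nonneg hC.isCompact hS₂
  rcases (minRelWidth_nonneg hC.isCompact hT).eq_or_lt' with hw | hw
  · exact hw.trans_le (add_nonneg hw₁ hw₂)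
  obtain ⟨u₁, hu₁⟩ := exists_width_eq_minRelWidth_mul hC hS₁
  obtain ⟨u₂, hu₂⟩ := exists_width_eq_minRelWidth_mul hC hS₂
  have hplanks := width_mul_width_le_of_subset_union hT hT' (nonempty_of_minRelWidth_pos hw)
    hS₁ hS₂ hTS u₁ u₂
  have hle (u : UnitVec d) := minRelWidth_mul_width_le hC hT u
  have hpos (u : UnitVec d) : 0 < width T u := (mul_pos hw (hC.width_pos u)).trans_le (hle u)
  refine le_of_mul_le_mul_right ?_ (mul_pos (hpos u₁) (hpos u₂))
  calc minRelWidth C T * (width T u₁ * width T u₂)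
      ≤ minRelWidth C T * (width S₁ u₁ * width T u₂ + width S₂ u₂ * width T u₁) := by gcongr
    _ = minRelWidth C S₁ * width T u₂ * (minRelWidth C T * width C u₁) +
        minRelWidth C S₂ * width T u₁ * (minRelWidth C T * width C u₂) := by
      rw [hu₁, hu₂]; ring
    _ ≤ minRelWidth C S₁ * width T u₂ * width T u₁ + minRelWidth C S₂ * width T u₁ * width T u₂ :=
      add_le_add (mul_le_mul_of_nonneg_left (hle u₁) (mul_nonneg hw₁ (hpos u₂).le))
        (mul_le_mul_of_nonneg_left (hle u₂) (mul_nonneg hw₂ (hpos u₁).le))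
    _ = (minRelWidth C S₁ + minRelWidth C S₂) * (width T u₁ * width T u₂) := by ring

/-- Shrunken copies of `S` inside `S`, one pushed to each end of `S` across the strip
`a < ⟨u, x⟩ < a + δ`, turn the parts of `S` outside the strip into a cover by two sets. -/
theorem smul_subset_vadd_union_vadd_of_removed_strip (hS : Convex ℝ S) (u : UnitVec d) {a δ l : ℝ}
    (hl₀ : 0 ≤ l) (hl₁ : l ≤ 1) {p q : E d} (hp : p ∈ S) (hq : q ∈ S)
    (hδ : δ ≤ l * (inner ℝ (u : E d) p - inner ℝ (u : E d) q)) :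
    (1 - l) • S ⊆ (-(l • q) +ᵥ S ∩ {x | inner ℝ (u : E d) x ≤ a}) ∪
      (-(l • p) +ᵥ S ∩ {x | a + δ ≤ inner ℝ (u : E d) x}) := by
  rintro _ ⟨s, hs, rfl⟩
  simp only [mem_union, mem_vadd_set_iff_neg_vadd_mem, neg_neg, vadd_eq_add]
  have hmem : ∀ {y}, y ∈ S → l • y + (1 - l) • s ∈ S := fun hy =>
    hS hy hs hl₀ (sub_nonneg.2 hl₁) (add_sub_cancel _ _)
  refine (le_total (inner ℝ (u : E d) (l • q + (1 - l) • s)) a).imp (⟨hmem hq, ·⟩)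
    fun h => ⟨hmem hp, ?_⟩
  simp only [mem_ofPred_eq, inner_add_right, real_inner_smul_right] at h ⊢
  linarith

theorem minRelWidth_le_add_add_of_removed_strip [Nonempty (UnitVec d)] (hC : IsConvexBody C)
    (hS : IsCompact S) (hS' : Convex ℝ S) (hρ : 0 ≤ ρ) (u : UnitVec d) (a : ℝ) :
    minRelWidth C S ≤ minRelWidth C (S ∩ {x | inner ℝ (u : E d) x ≤ a}) +
      minRelWidth C (S ∩ {x | a + ρ * width C u ≤ inner ℝ (u : E d) x}) + ρ := by
  set S₁ := S ∩ {x | inner ℝ (u : E d) x ≤ a}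
  set S₂ := S ∩ {x | a + ρ * width C u ≤ inner ℝ (u : E d) x}
  have hS₁ : IsCompact S₁ := hS.inter_right (isClosed_le (by fun_prop) continuous_const)
  have hS₂ : IsCompact S₂ := hS.inter_right (isClosed_le continuous_const (by fun_prop))
  rcases le_or_gt (minRelWidth C S) ρ with hwρ | hwρ
  · linarith [minRelWidth_nonneg hC.isCompact hS₁, minRelWidth_nonneg hC.isCompact hS₂]
  have hw : 0 < minRelWidth C S := hρ.trans_lt hwρ
  obtain ⟨p, hp, q, hq, hpq⟩ :=
    exists_inner_sub_inner_eq_width hS (nonempty_of_minRelWidth_pos hw) u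
  set l := ρ / minRelWidth C S
  have hl₀ : 0 ≤ l := div_nonneg hρ hw.le
  have hl₁ : l ≤ 1 := (div_le_one hw).2 hwρ.le
  have hlw : l * minRelWidth C S = ρ := div_mul_cancel₀ _ hw.ne'
  have hshift : ρ * width C u ≤ l * (inner ℝ (u : E d) p - inner ℝ (u : E d) q) := by
    rw [hpq, ← hlw, mul_assoc]
    exact mul_le_mul_of_nonneg_left (minRelWidth_mul_width_le hC hS u) hl₀
  have hsub := minRelWidth_le_add_of_subset_union hC (hS.smul _) (hS'.smul _) (hS₁.vadd _)
    (hS₂.vadd _) (smul_subset_vadd_union_vadd_of_removed_strip hS' u hl₀ hl₁ hp hq hshift)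
  rw [minRelWidth_smul (sub_nonneg.2 hl₁), minRelWidth_vadd hS₁, minRelWidth_vadd hS₂] at hsub
  linarith

end Subadditivity

section Slicing

variable {d : ℕ} {C K P Q : Set (E d)} {ρ : ℝ} {m : ℕ} {cuts : List (Hyperplane d)}
  {pieces : Multiset (Set (E d))}

theorem erosion_inter : erosion C (P ∩ Q) ρ = erosion C P ρ ∩ erosion C Q ρ := by
  ext t
  simp only [mem_inter_iff, mem_erosion_iff, forall₂_and]

theorem erosion_lower (hC : IsCompact C) (hC₀ : C.Nonempty) (hρ : 0 ≤ ρ) (H : Hyperplane d) :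
    erosion C H.lower ρ =
      {x | inner ℝ (H.normal : E d) x ≤ H.level - ρ * upperLevel C H.normal} := by
  ext t
  simp only [mem_erosion_iff, Hyperplane.lower, mem_ofPred_eq, inner_add_right,
    real_inner_smul_right, le_sub_iff_add_le]
  refine ⟨fun h => ?_, fun h c hc => le_trans ?_ h⟩
  · obtain ⟨c, hc, hcu⟩ := exists_inner_eq_upperLevel hC hC₀ H.normal
    exact hcu ▸ h c hc
  · gcongr
    exact inner_le_upperLevel hC hc

theorem erosion_upper (hC : IsCompact C) (hC₀ : C.Nonempty) (hρ : 0 ≤ ρ) (H : Hyperplane d) :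
    erosion C H.upper ρ =
      {x | H.level - ρ * lowerLevel C H.normal ≤ inner ℝ (H.normal : E d) x} := by
  ext t
  simp only [mem_erosion_iff, Hyperplane.upper, mem_ofPred_eq, inner_add_right,
    real_inner_smul_right, sub_le_iff_le_add]
  refine ⟨fun h => ?_, fun h c hc => h.trans ?_⟩
  · obtain ⟨c, hc, hcu⟩ := exists_inner_eq_lowerLevel hC hC₀ H.normal
    exact hcu ▸ h c hc
  · gcongr
    exact lowerLevel_le_inner hC hc

variable [Nonempty (UnitVec d)]

theorem minRelWidth_erosion_le_cut (hC : IsConvexBody C) (hP : IsCompact P) (hP' : Convex ℝ P)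
    (hρ : 0 ≤ ρ) (H : Hyperplane d) :
    minRelWidth C (erosion C P ρ) ≤ minRelWidth C (erosion C (P ∩ H.lower) ρ) +
      minRelWidth C (erosion C (P ∩ H.upper) ρ) + ρ := by
  have hlevel : H.level - ρ * lowerLevel C H.normal =
      H.level - ρ * upperLevel C H.normal + ρ * width C H.normal := by
    rw [width]; ring
  rw [erosion_inter, erosion_inter, erosion_lower hC.isCompact hC.nonempty hρ,
    erosion_upper hC.isCompact hC.nonempty hρ, hlevel]
  exact minRelWidth_le_add_add_of_removed_strip hC (isCompact_erosion hC.nonempty hP)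
    (convex_erosion hP') hρ H.normal _

theorem SlicedBy.minRelWidth_erosion_add_le_sum (hC : IsConvexBody C) (hK : IsConvexBody K)
    (h : SlicedBy K cuts pieces) (hρ : 0 ≤ ρ) :
    minRelWidth C (erosion C K ρ) + ρ ≤
      (pieces.map fun P => minRelWidth C (erosion C P ρ) + ρ).sum := by
  induction h with
  | uncut => simp
  | cut _ P _ H before _ ih =>
    have hP := before.isConvexBody hK P (Multiset.mem_cons_self _ _)
    have hcut := minRelWidth_erosion_le_cut hC hP.isCompact hP.convex hρ H
    simp only [Multiset.map_cons, Multiset.sum_cons] at ih ⊢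
    linarith

theorem SlicedBy.exists_successiveInradius_le (hC : IsConvexBody C) (hK : IsConvexBody K)
    (hm : 1 ≤ m) (h : SlicedBy K cuts pieces) :
    ∃ P ∈ pieces, successiveInradius C K (m * pieces.card) ≤ successiveInradius C P m := by
  have hcard : 0 < pieces.card := h.card_pieces ▸ Nat.succ_pos _
  obtain ⟨P, hP, hmax⟩ := exists_max_image _ (fun P => successiveInradius C P m)
    pieces.finite_toSet (Multiset.card_pos_iff_exists_mem.1 hcard)
  refine ⟨P, hP, ?_⟩
  by_contra! hlt
  set ρ := successiveInradius C P m
  have hpiece : ∀ Q ∈ pieces, IsSuccessiveInradius C Q m (successiveInradius C Q m) :=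
    fun Q hQ => isSuccessiveInradius_successiveInradius hC (h.isConvexBody hK Q hQ) hm
  have hρ : 0 ≤ ρ := (hpiece P hP).1.le
  have hmn : 1 ≤ m * pieces.card := Nat.mul_pos hm hcard
  refine lt_irrefl (((m * pieces.card : ℕ) : ℝ) * ρ) ?_
  calc ((m * pieces.card : ℕ) : ℝ) * ρ
      < minRelWidth C (erosion C K ρ) + ρ :=
        (isSuccessiveInradius_successiveInradius hC hK hmn).lt_minRelWidth_erosion_add hC
          hK.isCompact hmn hρ hlt
    _ ≤ (pieces.map fun Q => minRelWidth C (erosion C Q ρ) + ρ).sum :=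
        h.minRelWidth_erosion_add_le_sum hC hK hρ
    _ ≤ pieces.card • (m * ρ) := by
        rw [← Multiset.card_map fun Q => minRelWidth C (erosion C Q ρ) + ρ]
        exact Multiset.sum_le_card_nsmul _ _ (Multiset.forall_mem_map_iff.2 fun Q hQ =>
          (hpiece Q hQ).minRelWidth_erosion_add_le hC (h.isConvexBody hK Q hQ).isCompact hm
            (hmax Q hQ))
    _ = ((m * pieces.card : ℕ) : ℝ) * ρ := by push_cast [nsmul_eq_mul]; ring

end Slicing

section ParallelCuts

variable {d : ℕ} {C K Q R : Set (E d)} {ρ : ℝ} {m n : ℕ}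

theorem exists_mem_interior_inner_eq (hK : IsConvexBody K) (u : UnitVec d) {a : ℝ}
    (hl : lowerLevel K u < a) (hu : a < upperLevel K u) :
    ∃ x ∈ interior K, inner ℝ (u : E d) x = a := by
  have hcont : Continuous fun x : E d => inner ℝ (u : E d) x := by fun_prop
  have hdense : K ⊆ closure (interior K) := by
    rw [hK.convex.closure_interior_eq_closure_of_nonempty_interior hK.interior_nonempty]
    exact subset_closure
  obtain ⟨x, hx, hxu⟩ := exists_inner_eq_lowerLevel hK.isCompact hK.nonempty u
  obtain ⟨y, hy, hyu⟩ := exists_inner_eq_upperLevel hK.isCompact hK.nonempty u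
  obtain ⟨x', hx'a, hx'⟩ := mem_closure_iff.1 (hdense hx) {z | inner ℝ (u : E d) z < a}
    (isOpen_lt hcont continuous_const) (hxu.trans_lt hl)
  obtain ⟨y', hy'a, hy'⟩ := mem_closure_iff.1 (hdense hy) {z | a < inner ℝ (u : E d) z}
    (isOpen_lt continuous_const hcont) (hu.trans_eq hyu.symm)
  exact hK.convex.interior.isPreconnected.intermediate_value hx' hy' hcont.continuousOn
    ⟨hx'a.le, hy'a.le⟩

theorem exists_slicedBy_parallel (hK : IsConvexBody K) (u : UnitVec d) {t : ℕ → ℝ}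
    (ht : StrictMono t) (hR : ∀ x ∈ R, t 0 ≤ inner ℝ (u : E d) x) (hlow : lowerLevel K u ≤ t 0) :
    ∀ k : ℕ, t (k + 1) ≤ upperLevel K u → ∃ (P : Set (E d)) (rest : Multiset (Set (E d))),
      SlicedBy K ((List.range k).map fun i => ⟨u, t (i + 1)⟩) (P ::ₘ rest) ∧
      P ⊆ K ∧ interior K ∩ {x | t k < inner ℝ (u : E d) x} ⊆ P ∧
      (∀ x ∈ P ∩ R, t k ≤ inner ℝ (u : E d) x) ∧
      ∀ Q ∈ rest, Q ⊆ K ∧ ∃ i, ∀ x ∈ Q ∩ R, inner ℝ (u : E d) x ∈ Icc (t i) (t (i + 1))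
  | 0, _ => ⟨K, 0, SlicedBy.uncut, subset_rfl, inter_subset_left.trans interior_subset,
      fun x hx => hR x hx.2, fun _ hQ => absurd hQ (Multiset.notMem_zero _)⟩
  | k + 1, hupp => by
    have hlt : t (k + 1) < upperLevel K u := (ht (Nat.lt_succ_self _)).trans_le hupp
    obtain ⟨P, rest, hP, hPK, hKP, hPR, hrest⟩ :=
      exists_slicedBy_parallel hK u ht hR hlow k hlt.le
    let H : Hyperplane d := ⟨u, t (k + 1)⟩
    have hdivides : (interior P ∩ H.points).Nonempty := by
      obtain ⟨x, hx, hxu⟩ := exists_mem_interior_inner_eq hK u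
        (hlow.trans_lt (ht (Nat.succ_pos k))) hlt
      refine ⟨x, interior_maximal hKP (isOpen_interior.inter
        (isOpen_lt continuous_const (by fun_prop))) ⟨hx, ?_⟩, hxu⟩
      exact (ht (Nat.lt_succ_self k)).trans_eq hxu.symm
    have hupper : {x | t (k + 1) < inner ℝ (u : E d) x} ⊆ H.upper :=
      fun x (hx : t (k + 1) < inner ℝ (u : E d) x) => hx.le
    refine ⟨P ∩ H.upper, (P ∩ H.lower) ::ₘ rest, ?_, inter_subset_left.trans hPK,
      fun x hx => ⟨hKP ⟨hx.1, (ht (Nat.lt_succ_self k)).trans hx.2⟩, hupper hx.2⟩,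
      fun x hx => hx.1.2, Multiset.forall_mem_cons.2 ⟨⟨inter_subset_left.trans hPK, k,
        fun x hx => ⟨hPR x ⟨hx.1.1, hx.2⟩, hx.1.2⟩⟩, hrest⟩⟩
    rw [List.range_succ, List.map_append, Multiset.cons_swap]
    exact hP.cut _ P rest H hdivides

theorem exists_slicedBy_strips (hK : IsConvexBody K) (u : UnitVec d) {t : ℕ → ℝ}
    (ht : StrictMono t) {k : ℕ} (hR : ∀ x ∈ R, inner ℝ (u : E d) x ∈ Icc (t 0) (t (k + 1)))
    (hlow : lowerLevel K u ≤ t 0) (hupp : t (k + 1) ≤ upperLevel K u) :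
    ∃ pieces : Multiset (Set (E d)),
      SlicedBy K ((List.range k).map fun i => ⟨u, t (i + 1)⟩) pieces ∧
      ∀ P ∈ pieces, P ⊆ K ∧ ∃ i, ∀ x ∈ P ∩ R, inner ℝ (u : E d) x ∈ Icc (t i) (t (i + 1)) := by
  obtain ⟨P, rest, hP, hPK, -, hPR, hrest⟩ :=
    exists_slicedBy_parallel hK u ht (fun x hx => (hR x hx).1) hlow k hupp
  exact ⟨P ::ₘ rest, hP, Multiset.forall_mem_cons.2
    ⟨⟨hPK, k, fun x hx => ⟨hPR x hx, (hR x hx.2).2⟩⟩, hrest⟩⟩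

/-- In `equallySpacedCuts` the index list is coerced to a list of reals through the list monad. -/
theorem equallySpacedCuts_eq_map (L : Set (E d)) (u : UnitVec d) (n : ℕ) :
    equallySpacedCuts L u n = (List.range (n - 1)).map fun i => ⟨u,
      lowerLevel L u + ((i + 1 : ℕ) : ℝ) * (width L u / n)⟩ := by
  simp only [equallySpacedCuts, List.pure_def, List.bind_eq_flatMap, ← List.map_eq_flatMap,
    List.map_map, Nat.cast_add_one]
  rfl

variable [Nonempty (UnitVec d)]

theorem successiveInradius_le_of_strip (hC : IsConvexBody C) (hQ : IsConvexBody Q) (hm : 1 ≤ m)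
    (hρ : 0 ≤ ρ) (hQK : Q ⊆ K) (u : UnitVec d) {a : ℝ}
    (h : ∀ x ∈ Q ∩ roundedBody C K ρ, inner ℝ (u : E d) x ∈ Icc a (a + m * ρ * width C u)) :
    successiveInradius C Q m ≤ ρ := by
  by_contra! hlt
  have hr := isSuccessiveInradius_successiveInradius hC hQ hm
  have hne : (erosion C Q ρ).Nonempty := erosion_nonempty_of_le hC.convex hC.nonempty hρ hlt.le
    ((le_inradius_iff hC hQ.isCompact hr.1).1 hr.2.1)
  have hR : IsCompact (roundedBody C Q ρ) :=
    isCompact_roundedBody hC.isCompact hC.nonempty hQ.isCompact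
  have hRK : roundedBody C Q ρ ⊆ Q ∩ roundedBody C K ρ :=
    subset_inter roundedBody_subset (roundedBody_mono hQK)
  obtain ⟨x, hx, y, hy, hxy⟩ :=
    exists_inner_sub_inner_eq_width hR (roundedBody_nonempty hC.nonempty hne) u
  have hlarge : m * ρ < minRelWidth C (roundedBody C Q ρ) := by
    rw [minRelWidth_roundedBody hC hQ.isCompact hρ hne]
    exact hr.lt_minRelWidth_erosion_add hC hQ.isCompact hm hρ hlt
  have hsmall : minRelWidth C (roundedBody C Q ρ) * width C u ≤ m * ρ * width C u := by
    linarith [minRelWidth_mul_width_le hC hR u, (h x (hRK hx)).2, (h y (hRK hy)).1]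
  exact (le_of_mul_le_mul_right hsmall (hC.width_pos u)).not_gt hlarge

theorem exists_slicedBy_equallySpacedCuts (hC : IsConvexBody C) (hK : IsConvexBody K) (hm : 1 ≤ m)
    (hn : 1 ≤ n) (hρ : 0 < ρ) (hne : (erosion C K ρ).Nonempty) (u : UnitVec d)
    (hw : width (roundedBody C K ρ) u = n * (m * ρ * width C u)) :
    ∃ pieces : Multiset (Set (E d)),
      SlicedBy K (equallySpacedCuts (roundedBody C K ρ) u n) pieces ∧
      ∀ P ∈ pieces, successiveInradius C P m ≤ ρ := by
  have hR : IsCompact (roundedBody C K ρ) :=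
    isCompact_roundedBody hC.isCompact hC.nonempty hK.isCompact
  have hR₀ := roundedBody_nonempty hC.nonempty hne
  set h := m * ρ * width C u
  have hh : 0 < h := mul_pos (mul_pos (mod_cast hm) hρ) (hC.width_pos u)
  let t (i : ℕ) : ℝ := lowerLevel (roundedBody C K ρ) u + i * h
  have ht : StrictMono t := fun i j hij => by simp only [t]; gcongr
  have ht₀ : t 0 = lowerLevel (roundedBody C K ρ) u := by simp only [t, Nat.cast_zero]; ring
  have htn : t (n - 1 + 1) = upperLevel (roundedBody C K ρ) u := by
    rw [Nat.sub_add_cancel hn]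
    exact add_eq_of_eq_sub' hw.symm
  obtain ⟨pieces, hsliced, hstrips⟩ := exists_slicedBy_strips (R := roundedBody C K ρ) hK u ht
    (k := n - 1) (fun x hx => ⟨ht₀.trans_le (lowerLevel_le_inner hR hx),
      (inner_le_upperLevel hR hx).trans_eq htn.symm⟩)
    ((lowerLevel_anti hR₀ hK.isCompact roundedBody_subset).trans_eq ht₀.symm)
    (htn.trans_le (upperLevel_mono hR₀ hK.isCompact roundedBody_subset))
  refine ⟨pieces, ?_, fun P hP => ?_⟩
  · rwa [equallySpacedCuts_eq_map, hw, mul_div_cancel_left₀ _ (by positivity)]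
  · obtain ⟨hPK, i, hi⟩ := hstrips P hP
    refine successiveInradius_le_of_strip hC (hsliced.isConvexBody hK P hP) hm hρ.le hPK u
      (a := t i) ?_
    convert hi using 4
    simp only [t, Nat.cast_add_one]
    ring

theorem exists_isGreatestInradius_equallySpacedCuts (hC : IsConvexBody C) (hK : IsConvexBody K)
    (hm : 1 ≤ m) (hn : 1 ≤ n) (hρ : ρ = successiveInradius C K (m * n)) (u : UnitVec d)
    (hu : relWidth C (roundedBody C K ρ) u = minRelWidth C (roundedBody C K ρ)) :
    ∃ pieces : Multiset (Set (E d)), pieces.card = n ∧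
      SlicedBy K (equallySpacedCuts (roundedBody C K ρ) u n) pieces ∧
      IsGreatestInradius C m pieces ρ := by
  have hr := isSuccessiveInradius_successiveInradius hC hK (Nat.mul_pos hm hn)
  rw [← hρ] at hr
  rw [hr.2.2, relWidth, div_eq_iff (hC.width_pos u).ne'] at hu
  obtain ⟨pieces, hsliced, hle⟩ := exists_slicedBy_equallySpacedCuts hC hK hm hn hr.1
    ((le_inradius_iff hC hK.isCompact hr.1).1 hr.2.1) u (by rw [hu]; push_cast; ring)
  have hcard : pieces.card = n := by
    rw [hsliced.card_pieces, equallySpacedCuts_eq_map, List.length_map, List.length_range,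
      Nat.sub_add_cancel hn]
  obtain ⟨P, hP, hge⟩ := hsliced.exists_successiveInradius_le hC hK hm
  rw [hcard, ← hρ] at hge
  refine ⟨pieces, hcard, hsliced, ⟨P, hP, hge.antisymm (hle P hP)⟩, ?_⟩
  rintro _ ⟨Q, hQ, rfl⟩
  exact hle Q hQ

end ParallelCuts

end SuccessiveInradii

theorem theorem2p1 (d : ℕ) (hd : 2 ≤ d) (K C : Set (E d))
    (hK : IsConvexBody K) (hC : IsConvexBody C) (m n : ℕ) (hm : 1 ≤ m) (hn : 1 ≤ n) :
    -- the successive `C`-inradii are well defined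
    (∀ L : Set (E d), IsConvexBody L → ∀ k : ℕ, 1 ≤ k →
      ∃! ρ : ℝ, IsSuccessiveInradius C L k ρ) ∧
    -- the minimum, over all slicings, of the greatest `m`-th successive inradius of the pieces
    IsLeast
      {M : ℝ | ∃ (cuts : List (Hyperplane d)) (pieces : Multiset (Set (E d))),
        cuts.length = n - 1 ∧ pieces.card = n ∧ SlicedBy K cuts pieces ∧
        IsGreatestInradius C m pieces M}
      (successiveInradius C K (m * n)) ∧
    -- the minimal `C`-width of the rounded body is attained in some direction
    (∃ u : UnitVec d,
      relWidth C (roundedBody C K (successiveInradius C K (m * n))) u =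
        minRelWidth C (roundedBody C K (successiveInradius C K (m * n)))) ∧
    -- equally spaced parallel cuts along any such direction are optimal
    (∀ u : UnitVec d,
      relWidth C (roundedBody C K (successiveInradius C K (m * n))) u =
        minRelWidth C (roundedBody C K (successiveInradius C K (m * n))) →
      ∃ pieces : Multiset (Set (E d)),
        pieces.card = n ∧
        SlicedBy K
          (equallySpacedCuts (roundedBody C K (successiveInradius C K (m * n))) u n) pieces ∧
        IsGreatestInradius C m pieces (successiveInradius C K (m * n))) := by
  have : Nontrivial (Fin d) := Fin.nontrivial_iff_two_le.2 hd
  have : Nonempty (UnitVec d) := (NormedSpace.sphere_nonempty.2 zero_le_one).to_subtype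
  have hmin := exists_relWidth_eq_minRelWidth hC (isCompact_roundedBody
    (ρ := successiveInradius C K (m * n)) hC.isCompact hC.nonempty hK.isCompact)
  have hcuts := exists_isGreatestInradius_equallySpacedCuts hC hK hm hn rfl
  refine ⟨fun L hL k hk => existsUnique_isSuccessiveInradius hC hL hk, ⟨?_, ?_⟩, hmin, hcuts⟩
  · obtain ⟨u, hu⟩ := hmin
    obtain ⟨pieces, hcard, hsliced, hgreatest⟩ := hcuts u hu
    exact ⟨_, pieces, by simp [equallySpacedCuts_eq_map], hcard, hsliced, hgreatest⟩
  · rintro M ⟨cuts, pieces, -, rfl, hsliced, hgreatest⟩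
    obtain ⟨P, hP, hle⟩ := hsliced.exists_successiveInradius_le hC hK hm
    exact hle.trans (hgreatest.2 ⟨P, hP, rfl⟩)
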